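/- Let $I\subseteq\mathbb R$ be a nonempty open interval and let $d$ be a positive integer. For $f,g:I\to\mathbb R$ put $\mathscr D_{f,g}(x,y):=f(x)g(y)-f(y)g(x)$. Let $\mathscr C_3(I)$ be the class of pairs $(f,g)$ of three times continuously differentiable functions $f,g:I\to\mathbb R$ such that $\mathscr D_{f,g}(x,y)\neq 0$ for all distinct $x,y\in I$, and $f'(x)g(x)-f(x)g'(x)\neq0$ for all $x\in I$. Pairs $(f,g)$ and $(h,k)$ are called equivalent if there are real constants $\alpha,\beta,\gamma,\delta$ with $\alpha\delta-\beta\gamma\neq0$ such that $f=\alpha h+\beta k$ and $g=\gamma h+\delta k$ on $I$. Let $(T,\mathcal A,\mu)$ be a probability space, let $\varphi_1,\dots,\varphi_d:T\to[0,1]$ be $\mu$-measurable functions (that is, measurable with respect to the $\mu$-completion of $\mathcal A$) with $\varphi_1+\cdots+\varphi_d=1$, and set $$m(\boldsymbol x,t):=\varphi_1(t)x_1+\cdots+\varphi_d(t)x_d\qquad(\boldsymbol x=(x_1,\dots,x_d)\in I^d,\ t\in T).$$ For $(f,g)\in\mathscr C_3(I)$ and $\boldsymbol x\in I^d$, let $M_{f,g,m;\mu}(\boldsymbol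 x)$ be the (unique) $y\in I$ with $\int_T\mathscr D_{f,g}(m(\boldsymbol x,t),y)\,d\mu(t)=0$. Write $\varphi_i^*:=\varphi_i-\int_T\varphi_i\,d\mu$. Let $(f,g),(h,k)\in\mathscr C_3(I)$. Assume that $$\mu\big(\{t\in T\mid \varphi_1^*(t)=\cdots=\varphi_d^*(t)=0\}\big)<1$$ and that there exist $i,j,l\in\{1,\dots,d\}$ such that $\int_T\varphi_i^*\varphi_j^*\varphi_l^*\,d\mu\neq0$. Then the following assertions are equivalent: (i) $M_{f,g,m;\mu}(\boldsymbol x)=M_{h,k,m;\mu}(\boldsymbol x)$ for all $\boldsymbol x\in I^d$; (ii) there exist a dense subset $D\subseteq I$ and an open set $U\subseteq I^d$ containing $\{(x,\dots,x)\mid x\in D\}$ such that $M_{f,g,m;\mu}(\boldsymbol x)=M_{h,k,m;\mu}(\boldsymbol x)$ for all $\boldsymbol x\in U$; (iii) the pairs $(f,g)$ and $(h,k)$ are equivalent. -/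

import Mathlib

open MeasureTheory

noncomputable section

namespace Bajraktarevic

/-- The determinant `D_{f,g}(x,y) = f(x) g(y) - f(y) g(x)`. -/
def chebDet (f g : ℝ → ℝ) (x y : ℝ) : ℝ := f x * g y - f y * g x

/-- `(f, g)` is a (two-dimensional) Chebyshev system on `I`
(continuity is part of `ClassC`). -/
def IsChebyshev (I : Set ℝ) (f g : ℝ → ℝ) : Prop :=
  ∀ x ∈ I, ∀ y ∈ I, x ≠ y → chebDet f g x y ≠ 0

/-- The regularity class `C_n(I)` of pairs `(f, g)`, for an open interval `I`: `n` times
continuously differentiable Chebyshev systems on `I` (just continuous ones if `n = 0`) whose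
Wronski determinant does not vanish on `I` if `n ≥ 1`. Only the values on `I` matter. -/
structure ClassC (n : ℕ) (I : Set ℝ) (f g : ℝ → ℝ) : Prop where
  contDiffOn_fst : ContDiffOn ℝ n f I
  contDiffOn_snd : ContDiffOn ℝ n g I
  chebyshev : IsChebyshev I f g
  wronskian_ne_zero : 1 ≤ n → ∀ x ∈ I, deriv f x * g x - f x * deriv g x ≠ 0

/-- Equivalence of the pairs `(f, g)` and `(h, k)` on `I`. -/
def PairEquiv (I : Set ℝ) (f g h k : ℝ → ℝ) : Prop :=
  ∃ α β γ δ : ℝ, α * δ - β * γ ≠ 0 ∧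
    ∀ x ∈ I, f x = α * h x + β * k x ∧ g x = γ * h x + δ * k x

/-- The cube `I^d`. -/
def cube (I : Set ℝ) (d : ℕ) : Set (Fin d → ℝ) := {x | ∀ i, x i ∈ I}

/-- The generalized Bajraktarević mean `M_{f,g,m;μ}` at `x`: the element `y ∈ I` with
`∫ D_{f,g}(m(x,t), y) dμ(t) = 0`. For Chebyshev systems and families of means, such a `y` exists
and is unique; see `existsUnique_chebDet_integral` and `existsUnique_weightedFamily` below. -/
def genBajMean {T : Type*} [MeasurableSpace T] {d : ℕ} (I : Set ℝ) (f g : ℝ → ℝ)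
    (m : (Fin d → ℝ) → T → ℝ) (μ : Measure T) (x : Fin d → ℝ) : ℝ :=
  Classical.epsilon fun y : ℝ => y ∈ I ∧ ∫ t, chebDet f g (m x t) y ∂μ = 0

/-- The family of weighted arithmetic means `m(x,t) = φ₁(t) x₁ + ⋯ + φ_d(t) x_d`. -/
def weightedFamily {T : Type*} {d : ℕ} (φ : Fin d → T → ℝ) (x : Fin d → ℝ) (t : T) : ℝ :=
  ∑ i, φ i t * x i

/-- The centred function `φ* = φ - ∫ φ dμ`. -/
def centred {T : Type*} [MeasurableSpace T] (μ : Measure T) (φ : T → ℝ) (t : T) : ℝ :=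
  φ t - ∫ s, φ s ∂μ

theorem chebDet_left_nonneg {I : Set ℝ} (hI : I.OrdConnected) {f g : ℝ → ℝ}
    (hf : ContinuousOn f I) (hg : ContinuousOn g I) (hC : IsChebyshev I f g) {a b : ℝ}
    (ha : a ∈ I) (hb : b ∈ I) (hpos : 0 ≤ chebDet f g b a) :
    ∀ s ∈ Set.Icc a b, 0 ≤ chebDet f g s a ∧ chebDet f g s b ≤ 0 := by
  have hsub : Set.Icc a b ⊆ I := hI.out ha hb
  intro s hs
  constructor
  · by_contra! hneg
    have hc : ContinuousOn (fun u => chebDet f g u a) (Set.Icc s b) := by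
      have : Set.Icc s b ⊆ I := (Set.Icc_subset_Icc_left hs.1).trans hsub
      exact ((hf.mono this).mul continuousOn_const).sub (continuousOn_const.mul (hg.mono this))
    obtain ⟨u, hu, hu0⟩ := intermediate_value_Icc hs.2 hc ⟨hneg.le, hpos⟩
    have hua : u = a := by
      by_contra hne
      exact hC u (hsub ⟨hs.1.trans hu.1, hu.2⟩) a ha hne hu0
    have hsa : s = a := le_antisymm (hua ▸ hu.1) hs.1
    rw [hsa] at hneg
    simp [chebDet] at hneg
  · by_contra! hneg
    have hc : ContinuousOn (fun u => chebDet f g u b) (Set.Icc a s) := by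
      have : Set.Icc a s ⊆ I := (Set.Icc_subset_Icc_right hs.2).trans hsub
      exact ((hf.mono this).mul continuousOn_const).sub (continuousOn_const.mul (hg.mono this))
    have hneg' : chebDet f g a b ≤ 0 := by
      have : chebDet f g a b = - chebDet f g b a := by unfold chebDet; ring
      linarith
    obtain ⟨u, hu, hu0⟩ := intermediate_value_Icc hs.1 hc ⟨hneg', hneg.le⟩
    have hub : u = b := by
      by_contra hne
      exact hC u (hsub ⟨hu.1, hu.2.trans hs.2⟩) b hb hne hu0
    have hsb : s = b := le_antisymm hs.2 (hub ▸ hu.2)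
    rw [hsb] at hneg
    simp [chebDet] at hneg

theorem integrable_comp {T : Type*} [MeasurableSpace T] {μ : Measure T} [IsProbabilityMeasure μ]
    {a b : ℝ} (hab : a ≤ b) {f : ℝ → ℝ} (hf : ContinuousOn f (Set.Icc a b)) {m : T → ℝ}
    (hm : AEMeasurable m μ) (hmab : ∀ t, m t ∈ Set.Icc a b) :
    Integrable (fun t => f (m t)) μ := by
  have hext : Continuous (Set.IccExtend hab ((Set.Icc a b).domRestrict f)) :=
    (continuousOn_iff_continuous_domRestrict.1 hf).Icc_extend'
  have heq : (fun t => f (m t)) = fun t => Set.IccExtend hab ((Set.Icc a b).domRestrict f) (m t) := by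
    funext t
    rw [Set.IccExtend_of_mem _ _ (hmab t)]
    rfl
  obtain ⟨C, hCb⟩ := isCompact_Icc.exists_bound_of_continuousOn hf
  refine Integrable.of_bound (C := C) ?_ (Filter.Eventually.of_forall fun t => hCb _ (hmab t))
  rw [heq]
  exact (hext.measurable.comp_aemeasurable hm).aestronglyMeasurable

theorem existsUnique_aux {T : Type*} [MeasurableSpace T] {μ : Measure T} [IsProbabilityMeasure μ]
    {I : Set ℝ} (hI : I.OrdConnected) {f g : ℝ → ℝ}
    (hf : ContinuousOn f I) (hg : ContinuousOn g I) (hC : IsChebyshev I f g) {a b : ℝ}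
    (hab : a ≤ b) (ha : a ∈ I) (hb : b ∈ I) {m : T → ℝ}
    (hm : AEMeasurable m μ) (hmab : ∀ t, m t ∈ Set.Icc a b) (hpos : 0 ≤ chebDet f g b a) :
    ∃! y : ℝ, y ∈ I ∧ ∫ t, chebDet f g (m t) y ∂μ = 0 := by
  have hsub : Set.Icc a b ⊆ I := hI.out ha hb
  have hfi := integrable_comp (μ := μ) hab (hf.mono hsub) hm hmab
  have hgi := integrable_comp (μ := μ) hab (hg.mono hsub) hm hmab
  have hint : ∀ y, Integrable (fun t => chebDet f g (m t) y) μ := fun y =>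
    (hfi.mul_const _).sub (hgi.const_mul _)
  have hH : ∀ y, ∫ t, chebDet f g (m t) y ∂μ
      = (∫ t, f (m t) ∂μ) * g y - f y * ∫ t, g (m t) ∂μ := by
    intro y
    unfold chebDet
    rw [integral_sub (hfi.mul_const _) (hgi.const_mul _), integral_mul_const, integral_const_mul]
  have hsign := chebDet_left_nonneg hI hf hg hC ha hb hpos
  have hA : 0 ≤ ∫ t, chebDet f g (m t) a ∂μ := integral_nonneg fun t => (hsign _ (hmab t)).1
  have hB : ∫ t, chebDet f g (m t) b ∂μ ≤ 0 := integral_nonpos fun t => (hsign _ (hmab t)).2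
  have hcont : ContinuousOn (fun y => ∫ t, chebDet f g (m t) y ∂μ) (Set.Icc a b) := by
    simp_rw [hH]
    exact (continuousOn_const.mul (hg.mono hsub)).sub ((hf.mono hsub).mul continuousOn_const)
  obtain ⟨y, hy, hy0⟩ := intermediate_value_Icc' hab hcont ⟨hB, hA⟩
  refine ⟨y, ⟨hsub hy, hy0⟩, ?_⟩
  rintro z ⟨hz, hz0⟩
  by_contra hne
  have hD := hC z hz y (hsub hy) hne
  have hy1 := hH y
  have hz1 := hH z
  simp only [hz0] at hz1
  simp only [hy0] at hy1
  have hF : ∫ t, f (m t) ∂μ = 0 := by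
    refine (mul_eq_zero.1 ?_).resolve_right hD
    unfold chebDet
    linear_combination f y * hz1 - f z * hy1
  have hG : ∫ t, g (m t) ∂μ = 0 := by
    refine (mul_eq_zero.1 ?_).resolve_right hD
    unfold chebDet
    linear_combination g y * hz1 - g z * hy1
  have hall : ∀ u, ∫ t, chebDet f g (m t) u ∂μ = 0 := fun u => by rw [hH, hF, hG]; ring
  have h1 : ∀ᵐ t ∂μ, chebDet f g (m t) a = 0 :=
    (integral_eq_zero_iff_of_nonneg (fun t => (hsign _ (hmab t)).1) (hint a)).1 (hall a)
  have hma : ∀ᵐ t ∂μ, m t = a := by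
    filter_upwards [h1] with t ht
    by_contra hmt
    exact hC _ (hsub (hmab t)) a ha hmt ht
  have hfa : f a = 0 := by
    rw [← hF, integral_congr_ae (g := fun _ => f a) (by filter_upwards [hma] with t ht; rw [ht])]
    simp
  have hga : g a = 0 := by
    rw [← hG, integral_congr_ae (g := fun _ => g a) (by filter_upwards [hma] with t ht; rw [ht])]
    simp
  rcases eq_or_ne a y with rfl | hay
  · exact hC z hz a ha hne (by simp [chebDet, hfa, hga])
  · exact hC a ha y (hsub hy) hay (by simp [chebDet, hfa, hga])

/-- Well-definedness of the generalized Bajraktarević mean of a Chebyshev system: if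
`m(x, ·) = m` takes its values between two elements of the interval, then the defining equation
has exactly one solution. -/
theorem existsUnique_chebDet_integral {T : Type*} [MeasurableSpace T] {μ : Measure T}
    [IsProbabilityMeasure μ] {I : Set ℝ} (hI : I.OrdConnected) {f g : ℝ → ℝ}
    (hf : ContinuousOn f I) (hg : ContinuousOn g I) (hC : IsChebyshev I f g) {a b : ℝ}
    (hab : a ≤ b) (ha : a ∈ I) (hb : b ∈ I) {m : T → ℝ}
    (hm : AEMeasurable m μ) (hmab : ∀ t, m t ∈ Set.Icc a b) :
    ∃! y : ℝ, y ∈ I ∧ ∫ t, chebDet f g (m t) y ∂μ = 0 := by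
  rcases le_total 0 (chebDet f g b a) with h | h
  · exact existsUnique_aux hI hf hg hC hab ha hb hm hmab h
  · have hsw : ∀ x y, chebDet g f x y = - chebDet f g x y := fun x y => by unfold chebDet; ring
    have hC' : IsChebyshev I g f := fun x hx y hy hxy => by
      rw [hsw]; exact neg_ne_zero.2 (hC x hx y hy hxy)
    have := existsUnique_aux hI hg hf hC' hab ha hb hm hmab (by rw [hsw]; linarith)
    simpa only [hsw, integral_neg, neg_eq_zero] using this

/-- Well-definedness for families of weighted arithmetic means. -/
theorem existsUnique_weightedFamily {T : Type*} [MeasurableSpace T] {μ : Measure T}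
    [IsProbabilityMeasure μ] {d : ℕ} {I : Set ℝ} (hI : I.OrdConnected) {f g : ℝ → ℝ}
    (hf : ContinuousOn f I) (hg : ContinuousOn g I) (hC : IsChebyshev I f g)
    {φ : Fin d → T → ℝ} (hφ : ∀ i, AEMeasurable (φ i) μ)
    (hφ0 : ∀ i t, φ i t ∈ Set.Icc (0 : ℝ) 1) (hφ1 : ∀ t, ∑ i, φ i t = 1)
    {x : Fin d → ℝ} (hx : x ∈ cube I d) :
    ∃! y : ℝ, y ∈ I ∧ ∫ t, chebDet f g (weightedFamily φ x t) y ∂μ = 0 := by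
  obtain ⟨t₀⟩ : Nonempty T := nonempty_of_isProbabilityMeasure μ
  have hne : (Finset.univ : Finset (Fin d)).Nonempty := by
    by_contra hem
    have := hφ1 t₀
    rw [Finset.not_nonempty_iff_eq_empty.1 hem] at this
    simp at this
  obtain ⟨p, -, hp⟩ := Finset.exists_min_image Finset.univ x hne
  obtain ⟨q, -, hq⟩ := Finset.exists_max_image Finset.univ x hne
  refine existsUnique_chebDet_integral hI hf hg hC (hp q (Finset.mem_univ _)) (hx p) (hx q) ?_ ?_
  · unfold weightedFamily
    exact Finset.aemeasurable_fun_sum _ fun i _ => (hφ i).mul_const _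
  · intro t
    constructor
    · calc x p = ∑ i, φ i t * x p := by rw [← Finset.sum_mul, hφ1, one_mul]
        _ ≤ _ := Finset.sum_le_sum fun i hi => mul_le_mul_of_nonneg_left (hp i hi) (hφ0 i t).1
    · calc _ ≤ ∑ i, φ i t * x q :=
            Finset.sum_le_sum fun i hi => mul_le_mul_of_nonneg_left (hq i hi) (hφ0 i t).1
        _ = x q := by rw [← Finset.sum_mul, hφ1, one_mul]

end Bajraktarevic

end

open MeasureTheory Asymptotics Filter Topology

namespace Bajraktarevic

/-! ### Wronskian-type quotients -/

/-! Both `f` and `g` solve the equation `y'' = a y' + c y` with `a = coeffFst f g` and `c =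
coeffZero f g`, and on an interval the pair is determined by `a` and `c` up to an invertible linear
change of basis. Equivalence therefore reduces to recovering `a` and `c` from the mean.

Near a diagonal point `x`, replace `(f, g)` by the basis `p, q` of the same span with `p(x) = 0`,
`p'(x) = 1`, `q(x) = 1`, `q'(x) = 0`; this only rescales `D_{f,g}`. In a direction `z` for which `ψ
= ∑ φ_i z_i` has integral zero, the mean at `x + s z` is `x + p''(x) (∫ψ²) s² / 2 + p'''(x) (∫ψ³) s³
/ 6 + o(s³)` (`genBajMean_expansion`), where `p''(x) = a(x)` and `p'''(x) = coeffThird f g x`. The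
third-moment hypothesis yields, by polarization, a direction in which both moments are nonzero
(`exists_centred_direction`), so equal means near `x` force equal `coeffFst` and `coeffThird` at
`x`.

Continuity carries these equalities from the dense set to `I`. Since `c = coeffThird - a' - a²`, the
differential equations agree, and `pairEquiv_of_coeff_eq` concludes. Conversely, equivalent pairs
have proportional determinants, hence equal means. -/

/-- The Wronskian `f' g - f g'`. -/
noncomputable def wronskian (f g : ℝ → ℝ) (x : ℝ) : ℝ := deriv f x * g x - f x * deriv g x

/-- The first-order coefficient of the linear differential equation `y'' = a y' + c y`
satisfied by `f` and `g`. -/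
noncomputable def coeffFst (f g : ℝ → ℝ) (x : ℝ) : ℝ :=
  (deriv (deriv f) x * g x - f x * deriv (deriv g) x) / wronskian f g x

/-- The zeroth-order coefficient of the linear differential equation `y'' = a y' + c y`
satisfied by `f` and `g`. -/
noncomputable def coeffZero (f g : ℝ → ℝ) (x : ℝ) : ℝ :=
  (deriv f x * deriv (deriv g) x - deriv g x * deriv (deriv f) x) / wronskian f g x

/-- The third derivative at `x` of the combination of `f` and `g` that vanishes at `x` with unit
slope. -/
noncomputable def coeffThird (f g : ℝ → ℝ) (x : ℝ) : ℝ :=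
  (deriv (deriv (deriv f)) x * g x - f x * deriv (deriv (deriv g)) x) / wronskian f g x

section Regularity

variable {I : Set ℝ} {f g h k : ℝ → ℝ}

theorem contDiffOn_deriv_of_isOpen (hI : IsOpen I) {n : ℕ} (hf : ContDiffOn ℝ (n + 1 : ℕ) f I) :
    ContDiffOn ℝ n (deriv f) I :=
  hf.deriv_of_isOpen hI (by norm_cast)

theorem hasDerivAt_of_contDiffOn (hI : IsOpen I) {n : ℕ} (hf : ContDiffOn ℝ (n + 1 : ℕ) f I)
    {x : ℝ} (hx : x ∈ I) : HasDerivAt f (deriv f x) x :=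
  ((hf.differentiableOn (by norm_cast)).differentiableAt (hI.mem_nhds hx)).hasDerivAt

theorem ClassC.hasDerivAt_wronskian (hI : IsOpen I) (hfg : ClassC 3 I f g) {x : ℝ} (hx : x ∈ I) :
    HasDerivAt (wronskian f g) (deriv (deriv f) x * g x - f x * deriv (deriv g) x) x := by
  have f0 := hasDerivAt_of_contDiffOn hI (n := 2) hfg.contDiffOn_fst hx
  have g0 := hasDerivAt_of_contDiffOn hI (n := 2) hfg.contDiffOn_snd hx
  have f1 := hasDerivAt_of_contDiffOn hI (n := 1)
    (contDiffOn_deriv_of_isOpen hI (n := 2) hfg.contDiffOn_fst) hx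
  have g1 := hasDerivAt_of_contDiffOn hI (n := 1)
    (contDiffOn_deriv_of_isOpen hI (n := 2) hfg.contDiffOn_snd) hx
  exact ((f1.mul g0).sub (f0.mul g1)).congr_deriv (by ring)

/-- The numerator of `coeffFst` is the derivative of the Wronskian, which produces the square. The
formula expresses `coeffZero` through the two coefficients visible in the expansion of the mean. -/
theorem ClassC.hasDerivAt_coeffFst (hI : IsOpen I) (hfg : ClassC 3 I f g) {x : ℝ} (hx : x ∈ I) :
    HasDerivAt (coeffFst f g) (coeffThird f g x - coeffZero f g x - coeffFst f g x ^ 2) x := by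
  have f0 := hasDerivAt_of_contDiffOn hI (n := 2) hfg.contDiffOn_fst hx
  have g0 := hasDerivAt_of_contDiffOn hI (n := 2) hfg.contDiffOn_snd hx
  have f2 := hasDerivAt_of_contDiffOn hI (n := 0) (contDiffOn_deriv_of_isOpen hI (n := 1)
    (contDiffOn_deriv_of_isOpen hI (n := 2) hfg.contDiffOn_fst)) hx
  have g2 := hasDerivAt_of_contDiffOn hI (n := 0) (contDiffOn_deriv_of_isOpen hI (n := 1)
    (contDiffOn_deriv_of_isOpen hI (n := 2) hfg.contDiffOn_snd)) hx
  have hW : wronskian f g x ≠ 0 := hfg.wronskian_ne_zero (by norm_num) x hx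
  refine (((f2.mul g0).sub (f0.mul g2)).div (hfg.hasDerivAt_wronskian hI hx) hW).congr_deriv ?_
  simp only [coeffFst, coeffThird, coeffZero, Pi.sub_apply, Pi.mul_apply]
  field_simp
  ring

/-- Needed to pass from a dense set to `I`; third derivatives are merely continuous here, so nothing
stronger is available. -/
theorem ClassC.continuousOn_coeffThird (hI : IsOpen I) (hfg : ClassC 3 I f g) :
    ContinuousOn (coeffThird f g) I := by
  have f3 : ContDiffOn ℝ (0 : ℕ) (deriv (deriv (deriv f))) I :=
    contDiffOn_deriv_of_isOpen hI (contDiffOn_deriv_of_isOpen hI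
      (contDiffOn_deriv_of_isOpen hI (n := 2) hfg.contDiffOn_fst))
  have g3 : ContDiffOn ℝ (0 : ℕ) (deriv (deriv (deriv g))) I :=
    contDiffOn_deriv_of_isOpen hI (contDiffOn_deriv_of_isOpen hI
      (contDiffOn_deriv_of_isOpen hI (n := 2) hfg.contDiffOn_snd))
  refine ContinuousOn.div ?_ (fun x hx =>
    (hfg.hasDerivAt_wronskian hI hx).continuousAt.continuousWithinAt)
    (hfg.wronskian_ne_zero (by norm_num))
  exact (f3.continuousOn.mul hfg.contDiffOn_snd.continuousOn).sub
    (hfg.contDiffOn_fst.continuousOn.mul g3.continuousOn)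

theorem deriv_deriv_fst_eq {x : ℝ} (hW : wronskian f g x ≠ 0) :
    deriv (deriv f) x = coeffFst f g x * deriv f x + coeffZero f g x * f x := by
  simp only [coeffFst, coeffZero]
  field_simp
  simp only [wronskian]
  ring

theorem deriv_deriv_snd_eq {x : ℝ} (hW : wronskian f g x ≠ 0) :
    deriv (deriv g) x = coeffFst f g x * deriv g x + coeffZero f g x * g x := by
  simp only [coeffFst, coeffZero]
  field_simp
  simp only [wronskian]
  ring

/-- A solution of a second-order linear differential equation is a linear combination of a
fundamental system of solutions. -/
theorem exists_eq_linear_combination (hI : IsOpen I) (hIc : IsPreconnected I)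
    (hhk : ClassC 3 I h k) (hf : ContDiffOn ℝ 3 f I)
    (hode : ∀ x ∈ I, deriv (deriv f) x = coeffFst h k x * deriv f x + coeffZero h k x * f x) :
    ∃ α β : ℝ, ∀ x ∈ I, f x = α * h x + β * k x := by
  have hW : ∀ x ∈ I, wronskian h k x ≠ 0 := hhk.wronskian_ne_zero (by norm_num)
  -- Abel's formula: every Wronskian of two solutions satisfies `W' = a W`, so quotients of such
  -- Wronskians are constant.
  have key : ∀ u : ℝ → ℝ, ContDiffOn ℝ 3 u I →
      (∀ x ∈ I, deriv (deriv u) x = coeffFst h k x * deriv u x + coeffZero h k x * u x) →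
      ∃ α : ℝ, ∀ x ∈ I, wronskian f u x / wronskian h k x = α := by
    intro u hu hode'
    have hder : ∀ x ∈ I, HasDerivAt (fun y => wronskian f u y / wronskian h k y) 0 x := by
      intro x hx
      have f0 := hasDerivAt_of_contDiffOn hI (n := 2) hf hx
      have u0 := hasDerivAt_of_contDiffOn hI (n := 2) hu hx
      have f1 := hasDerivAt_of_contDiffOn hI (n := 1)
        (contDiffOn_deriv_of_isOpen hI (n := 2) hf) hx
      have u1 := hasDerivAt_of_contDiffOn hI (n := 1)
        (contDiffOn_deriv_of_isOpen hI (n := 2) hu) hx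
      have hfu : HasDerivAt (wronskian f u) (coeffFst h k x * wronskian f u x) x := by
        refine ((f1.mul u0).sub (f0.mul u1)).congr_deriv ?_
        rw [hode x hx, hode' x hx, wronskian]
        ring
      have hhk' : HasDerivAt (wronskian h k) (coeffFst h k x * wronskian h k x) x := by
        refine (hhk.hasDerivAt_wronskian hI hx).congr_deriv ?_
        rw [coeffFst, div_mul_cancel₀ _ (hW x hx)]
      refine (hfu.div hhk' (hW x hx)).congr_deriv ?_
      rw [div_eq_zero_iff]
      left
      ring
    exact hI.exists_is_const_of_deriv_eq_zero hIc
      (fun x hx => (hder x hx).differentiableAt.differentiableWithinAt)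
      fun x hx => (hder x hx).deriv
  obtain ⟨α, hα⟩ := key k hhk.contDiffOn_snd fun x hx => deriv_deriv_snd_eq (hW x hx)
  obtain ⟨β, hβ⟩ := key h hhk.contDiffOn_fst fun x hx => deriv_deriv_fst_eq (hW x hx)
  -- Cramer's rule for the system expressing `f` and `f'` through `h` and `k`.
  refine ⟨α, -β, fun x hx => ?_⟩
  rw [← hα x hx, ← hβ x hx]
  have := hW x hx
  field_simp
  simp only [wronskian]
  ring

/-- Pairs whose coefficient functions `coeffFst` and `coeffThird` coincide are equivalent. -/
theorem pairEquiv_of_coeff_eq (hI : IsOpen I) (hIc : IsPreconnected I) (hne : I.Nonempty)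
    (hfg : ClassC 3 I f g) (hhk : ClassC 3 I h k)
    (h1 : Set.EqOn (coeffFst f g) (coeffFst h k) I)
    (h3 : Set.EqOn (coeffThird f g) (coeffThird h k) I) : PairEquiv I f g h k := by
  have h0 : Set.EqOn (coeffZero f g) (coeffZero h k) I := by
    intro x hx
    -- The first coefficients agree on an open set, so their derivatives agree too.
    have hev : coeffFst f g =ᶠ[𝓝 x] coeffFst h k := h1.eventuallyEq_of_mem (hI.mem_nhds hx)
    have := ((hfg.hasDerivAt_coeffFst hI hx).congr_of_eventuallyEq hev.symm).unique
      (hhk.hasDerivAt_coeffFst hI hx)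
    rw [h1 hx, h3 hx] at this
    linarith
  have hW : ∀ x ∈ I, wronskian f g x ≠ 0 := hfg.wronskian_ne_zero (by norm_num)
  obtain ⟨α, β, hf⟩ := exists_eq_linear_combination hI hIc hhk hfg.contDiffOn_fst fun x hx => by
    rw [← h1 hx, ← h0 hx]; exact deriv_deriv_fst_eq (hW x hx)
  obtain ⟨γ, δ, hg⟩ := exists_eq_linear_combination hI hIc hhk hfg.contDiffOn_snd fun x hx => by
    rw [← h1 hx, ← h0 hx]; exact deriv_deriv_snd_eq (hW x hx)
  refine ⟨α, β, γ, δ, fun hdet => ?_, fun x hx => ⟨hf x hx, hg x hx⟩⟩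
  obtain ⟨x, hx⟩ := hne
  have h' := hasDerivAt_of_contDiffOn hI (n := 2) hhk.contDiffOn_fst hx
  have k' := hasDerivAt_of_contDiffOn hI (n := 2) hhk.contDiffOn_snd hx
  have hcomb : ∀ {u : ℝ → ℝ} {a b : ℝ}, (∀ y ∈ I, u y = a * h y + b * k y) →
      deriv u x = a * deriv h x + b * deriv k x := by
    intro u a b hu
    refine HasDerivAt.deriv (((h'.const_mul a).add (k'.const_mul b)).congr_of_eventuallyEq ?_)
    filter_upwards [hI.mem_nhds hx] with y hy using hu y hy
  refine hW x hx ?_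
  rw [wronskian, hcomb hf, hcomb hg, hf x hx, hg x hx]
  -- The Wronskian of `(f, g)` is `α δ - β γ` times that of `(h, k)`, so a zero determinant would
  -- make it vanish.
  linear_combination (deriv h x * k x - h x * deriv k x) * hdet

end Regularity

/-! ### Asymptotic expansions -/

/-- Third-order Taylor expansion of a function on an open interval. -/
theorem taylor_three_isLittleO {I : Set ℝ} (hI : IsOpen I) (hIc : I.OrdConnected) {f : ℝ → ℝ}
    (hf : ContDiffOn ℝ 3 f I) {x : ℝ} (hx : x ∈ I) :
    (fun u => f (x + u) - (f x + deriv f x * u + deriv (deriv f) x / 2 * u ^ 2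
      + deriv (deriv (deriv f)) x / 6 * u ^ 3)) =o[𝓝 0] fun u => u ^ 3 := by
  have h := taylor_isLittleO (n := 3) hIc.convex hx hf
  rw [hI.nhdsWithin_eq hx] at h
  have ht : Tendsto (fun u => x + u) (𝓝 0) (𝓝 x) := by
    have : Continuous fun u : ℝ => x + u := by fun_prop
    simpa using this.tendsto 0
  have h' := h.comp_tendsto ht
  simp only [Function.comp_def, add_sub_cancel_left] at h'
  refine h'.congr_left fun u => ?_
  have hd : ∀ n, iteratedDerivWithin n f I x = iteratedDeriv n f x := fun n =>
    iteratedDerivWithin_of_isOpen hI hx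
  simp only [taylor_within_apply, Finset.sum_range_succ, hd, iteratedDeriv_succ,
    iteratedDeriv_zero]
  simp [Nat.factorial]
  ring

/-- If `w` solves `Q(s) p(w) = P(s) q(w)`, where `p(u) = u + O(u²)`, `q(u) = 1 + O(u²)`,
`Q(s) = 1 + O(s²)` and `P(s) = A s² + B s³ + o(s³)`, then `w` has the expansion of `P`. -/
theorem isLittleO_implicit {P Q p q w : ℝ → ℝ} {A B : ℝ}
    (hw : w =O[𝓝 0] fun s => s)
    (heq : ∀ᶠ s in 𝓝 0, Q s * p (w s) = P s * q (w s))
    (hP : (fun s => P s - (A * s ^ 2 + B * s ^ 3)) =o[𝓝 0] fun s => s ^ 3)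
    (hQ : (fun s => Q s - 1) =O[𝓝 0] fun s => s ^ 2)
    (hp : (fun u => p u - u) =O[𝓝 0] fun u => u ^ 2)
    (hq : (fun u => q u - 1) =O[𝓝 0] fun u => u ^ 2) :
    (fun s => w s - (A * s ^ 2 + B * s ^ 3)) =o[𝓝 0] fun s => s ^ 3 := by
  have hpow' : ∀ {m n : ℕ}, n < m → (fun s : ℝ => s ^ m) =o[𝓝 0] fun s => s ^ n := fun h =>
    isLittleO_pow_pow h
  have hpow : ∀ {m n : ℕ}, n ≤ m → (fun s : ℝ => s ^ m) =O[𝓝 0] fun s => s ^ n := fun h =>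
    h.lt_or_eq.elim (fun h => (hpow' h).isBigO) fun h => h ▸ isBigO_refl _ _
  have hw0 : Tendsto w (𝓝 0) (𝓝 0) := hw.trans_tendsto tendsto_id
  have hpw : (fun s => p (w s) - w s) =O[𝓝 0] fun s => w s ^ 2 := hp.comp_tendsto hw0
  have hqw : (fun s => q (w s) - 1) =O[𝓝 0] fun s => w s ^ 2 := hq.comp_tendsto hw0
  have hP2 : P =O[𝓝 0] fun s => s ^ 2 := by
    have h1 : (fun s : ℝ => A * s ^ 2 + B * s ^ 3) =O[𝓝 0] fun s => s ^ 2 :=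
      ((isBigO_refl _ _).const_mul_left A).add ((hpow (by norm_num)).const_mul_left B)
    simpa using (hP.isBigO.trans (hpow (by norm_num))).add h1
  -- The equation is solved for `w - P`; two passes through this identity bootstrap `w = O(s)` to `w
  -- = O(s²)` and then to `w = P + o(s³)`.
  have hdecomp : ∀ᶠ s in 𝓝 0, w s - P s
      = P s * (q (w s) - 1) - (Q s - 1) * (p (w s) - w s) - (Q s - 1) * w s
        - (p (w s) - w s) := by
    filter_upwards [heq] with s hs
    linear_combination hs
  have hw2 : w =O[𝓝 0] fun s => s ^ 2 := by
    have e1 : (fun s => w s ^ 2) =O[𝓝 0] fun s => s ^ 2 := hw.pow 2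
    have b1 : (fun s => P s * (q (w s) - 1)) =O[𝓝 0] fun s => s ^ 2 :=
      ((hP2.mul (hqw.trans e1)).congr_right fun s => by rw [← pow_add]).trans (hpow (by norm_num))
    have b2 : (fun s => (Q s - 1) * (p (w s) - w s)) =O[𝓝 0] fun s => s ^ 2 :=
      ((hQ.mul (hpw.trans e1)).congr_right fun s => by rw [← pow_add]).trans (hpow (by norm_num))
    have b3 : (fun s => (Q s - 1) * w s) =O[𝓝 0] fun s => s ^ 2 :=
      ((hQ.mul hw).congr_right fun s => by rw [← pow_succ]).trans (hpow (by norm_num))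
    have := (((b1.sub b2).sub b3).sub (hpw.trans e1)).congr'
      (hdecomp.mono fun s hs => hs.symm) EventuallyEq.rfl
    simpa using this.add hP2
  -- Second pass: `p(w) - w` is now `O(s⁴)`, so the quadratic terms of `p` and `q` no longer affect
  -- the third order.
  have e2 : (fun s => w s ^ 2) =O[𝓝 0] fun s => s ^ 4 :=
    (hw2.pow 2).congr_right fun s => by ring
  have b1 : (fun s => P s * (q (w s) - 1)) =o[𝓝 0] fun s => s ^ 3 :=
    ((hP2.mul (hqw.trans e2)).congr_right fun s => by rw [← pow_add]).trans_isLittleO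
      (hpow' (by norm_num))
  have b2 : (fun s => (Q s - 1) * (p (w s) - w s)) =o[𝓝 0] fun s => s ^ 3 :=
    ((hQ.mul (hpw.trans e2)).congr_right fun s => by rw [← pow_add]).trans_isLittleO
      (hpow' (by norm_num))
  have b3 : (fun s => (Q s - 1) * w s) =o[𝓝 0] fun s => s ^ 3 :=
    ((hQ.mul hw2).congr_right fun s => by rw [← pow_add]).trans_isLittleO (hpow' (by norm_num))
  have b4 : (fun s => p (w s) - w s) =o[𝓝 0] fun s => s ^ 3 :=
    (hpw.trans e2).trans_isLittleO (hpow' (by norm_num))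
  have := (((b1.sub b2).sub b3).sub b4).congr'
    (hdecomp.mono fun s hs => hs.symm) EventuallyEq.rfl
  refine (this.add hP).congr_left fun s => by ring

/-- A polynomial `a s² + b s³` that is `o(s³)` vanishes. -/
theorem coeff_eq_zero_of_isLittleO {a b : ℝ}
    (h : (fun s : ℝ => a * s ^ 2 + b * s ^ 3) =o[𝓝 0] fun s => s ^ 3) : a = 0 ∧ b = 0 := by
  have hne : Tendsto (fun s : ℝ => s) (𝓝[≠] 0) (𝓝 0) := nhdsWithin_le_nhds
  have hmem : ∀ᶠ s : ℝ in 𝓝[≠] 0, s ≠ 0 := eventually_mem_nhdsWithin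
  have hlim := (h.mono (nhdsWithin_le_nhds (s := {0}ᶜ))).tendsto_div_nhds_zero
  have ha : a = 0 := by
    have h1 : Tendsto (fun s : ℝ => a + b * s) (𝓝[≠] 0) (𝓝 0) := by
      refine (by simpa using hlim.mul hne : Tendsto _ _ (𝓝 (0 : ℝ))).congr' ?_
      filter_upwards [hmem] with s hs
      field_simp
    have h2 : Tendsto (fun s : ℝ => a + b * s) (𝓝[≠] 0) (𝓝 a) := by
      simpa using (hne.const_mul b).const_add a
    exact tendsto_nhds_unique h2 h1
  refine ⟨ha, ?_⟩
  have h1 : Tendsto (fun _ : ℝ => b) (𝓝[≠] 0) (𝓝 0) := by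
    refine hlim.congr' ?_
    filter_upwards [hmem] with s hs
    rw [ha]
    field_simp
    ring
  exact tendsto_nhds_unique tendsto_const_nhds h1

/-- Integration of a third-order expansion along a bounded perturbation. -/
theorem integral_expansion_isLittleO {T : Type*} [MeasurableSpace T] {μ : Measure T}
    [IsProbabilityMeasure μ] {ψ : T → ℝ} (hψ : AEMeasurable ψ μ) {K : ℝ} (hK : ∀ t, |ψ t| ≤ K)
    {F : ℝ → ℝ} {x c₀ c₁ c₂ c₃ : ℝ}
    (hint : ∀ᶠ s in 𝓝 0, Integrable (fun t => F (x + s * ψ t)) μ)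
    (hF : (fun u => F (x + u) - (c₀ + c₁ * u + c₂ * u ^ 2 + c₃ * u ^ 3)) =o[𝓝 0]
      fun u => u ^ 3) :
    (fun s => ∫ t, F (x + s * ψ t) ∂μ - (c₀ + c₁ * (∫ t, ψ t ∂μ) * s
      + c₂ * (∫ t, ψ t ^ 2 ∂μ) * s ^ 2 + c₃ * (∫ t, ψ t ^ 3 ∂μ) * s ^ 3)) =o[𝓝 0]
      fun s => s ^ 3 := by
  obtain ⟨t₀⟩ : Nonempty T := nonempty_of_isProbabilityMeasure μ
  have hK0 : 0 ≤ K := (abs_nonneg _).trans (hK t₀)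
  have hψp : ∀ n, Integrable (fun t => ψ t ^ n) μ := fun n =>
    Integrable.of_bound (hψ.pow_const n).aestronglyMeasurable (K ^ n)
      (Eventually.of_forall fun t => by
        rw [Real.norm_eq_abs, abs_pow]
        exact pow_le_pow_left₀ (abs_nonneg _) (hK t) n)
  have hψ1 : Integrable ψ μ := by simpa using hψp 1
  rw [isLittleO_iff]
  intro c hc
  -- `K + 1` instead of `K` avoids division by zero when `K = 0`.
  have hε : 0 < c / (K + 1) ^ 3 := by positivity
  obtain ⟨δ, hδ, hball⟩ := Metric.eventually_nhds_iff.1 ((isLittleO_iff.1 hF) hε)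
  have hsmall : ∀ᶠ s : ℝ in 𝓝 0, |s| * K < δ := by
    have : Tendsto (fun s : ℝ => |s| * K) (𝓝 0) (𝓝 0) := by
      have : Continuous fun s : ℝ => |s| * K := by fun_prop
      simpa using this.tendsto 0
    exact this.eventually_lt_const hδ
  filter_upwards [hint, hsmall] with s hs hsδ
  have hpoly : ∫ t, F (x + s * ψ t) ∂μ - (c₀ + c₁ * (∫ t, ψ t ∂μ) * s
      + c₂ * (∫ t, ψ t ^ 2 ∂μ) * s ^ 2 + c₃ * (∫ t, ψ t ^ 3 ∂μ) * s ^ 3)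
      = ∫ t, (F (x + s * ψ t) - (c₀ + c₁ * (s * ψ t) + c₂ * (s * ψ t) ^ 2
        + c₃ * (s * ψ t) ^ 3)) ∂μ := by
    have i1 : Integrable (fun t => c₁ * (s * ψ t)) μ := (hψ1.const_mul s).const_mul c₁
    have i2 : Integrable (fun t => c₂ * (s * ψ t) ^ 2) μ := by
      simpa only [mul_pow] using ((hψp 2).const_mul (s ^ 2)).const_mul c₂
    have i3 : Integrable (fun t => c₃ * (s * ψ t) ^ 3) μ := by
      simpa only [mul_pow] using ((hψp 3).const_mul (s ^ 3)).const_mul c₃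
    have i0 : Integrable (fun _ : T => c₀) μ := integrable_const _
    have i01 : Integrable (fun t => c₀ + c₁ * (s * ψ t)) μ := i0.add i1
    have i012 : Integrable (fun t => c₀ + c₁ * (s * ψ t) + c₂ * (s * ψ t) ^ 2) μ := i01.add i2
    have i0123 : Integrable (fun t => c₀ + c₁ * (s * ψ t) + c₂ * (s * ψ t) ^ 2
      + c₃ * (s * ψ t) ^ 3) μ := i012.add i3
    rw [integral_sub hs i0123, integral_add i012 i3, integral_add i01 i2, integral_add i0 i1]
    simp only [mul_pow, integral_const_mul, integral_const, probReal_univ, one_smul]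
    ring
  rw [hpoly]
  have hb : ∀ t, ‖F (x + s * ψ t) - (c₀ + c₁ * (s * ψ t) + c₂ * (s * ψ t) ^ 2
      + c₃ * (s * ψ t) ^ 3)‖ ≤ c * ‖s ^ 3‖ := by
    intro t
    have habs : |s * ψ t| ≤ |s| * K := by
      rw [abs_mul]
      exact mul_le_mul_of_nonneg_left (hK t) (abs_nonneg _)
    refine (hball (by simpa using habs.trans_lt hsδ)).trans ?_
    have h1 : ‖(s * ψ t) ^ 3‖ ≤ |s| ^ 3 * (K + 1) ^ 3 := by
      rw [Real.norm_eq_abs, abs_pow, ← mul_pow]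
      refine pow_le_pow_left₀ (abs_nonneg _) (habs.trans ?_) 3
      exact mul_le_mul_of_nonneg_left (by linarith) (abs_nonneg _)
    calc c / (K + 1) ^ 3 * ‖(s * ψ t) ^ 3‖
        ≤ c / (K + 1) ^ 3 * (|s| ^ 3 * (K + 1) ^ 3) := mul_le_mul_of_nonneg_left h1 hε.le
      _ = c * ‖s ^ 3‖ := by
        rw [Real.norm_eq_abs, abs_pow]
        field_simp
  simpa using norm_integral_le_of_norm_le_const (μ := μ) (Eventually.of_forall hb)

/-! ### Expansions in the basis normalized at a point. -/

section Normalization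

variable {F G : ℝ → ℝ} {f₀ f₁ f₂ f₃ g₀ g₁ g₂ g₃ m₁ m₂ m₃ : ℝ}

theorem normalized_fst_isLittleO (hW : f₁ * g₀ - f₀ * g₁ ≠ 0)
    (hF : (fun s => F s - (f₀ + f₁ * m₁ * s + f₂ / 2 * m₂ * s ^ 2 + f₃ / 6 * m₃ * s ^ 3))
      =o[𝓝 0] fun s => s ^ 3)
    (hG : (fun s => G s - (g₀ + g₁ * m₁ * s + g₂ / 2 * m₂ * s ^ 2 + g₃ / 6 * m₃ * s ^ 3))
      =o[𝓝 0] fun s => s ^ 3) :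
    (fun s => (F s * g₀ - f₀ * G s) / (f₁ * g₀ - f₀ * g₁) - (m₁ * s
      + (f₂ * g₀ - f₀ * g₂) / (f₁ * g₀ - f₀ * g₁) * m₂ / 2 * s ^ 2
      + (f₃ * g₀ - f₀ * g₃) / (f₁ * g₀ - f₀ * g₁) * m₃ / 6 * s ^ 3)) =o[𝓝 0] fun s => s ^ 3 := by
  refine ((hF.const_mul_left (g₀ / (f₁ * g₀ - f₀ * g₁))).sub
    (hG.const_mul_left (f₀ / (f₁ * g₀ - f₀ * g₁)))).congr_left fun s => ?_
  have e : m₁ * s = (f₁ * g₀ - f₀ * g₁) * (m₁ * s) * (f₁ * g₀ - f₀ * g₁)⁻¹ := by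
    rw [mul_right_comm, mul_inv_cancel₀ hW, one_mul]
  linear_combination e

/-- The linear terms `f₁ g₁ m₁ s` cancel, whatever the value of `m₁`. -/
theorem normalized_snd_isBigO (hW : f₁ * g₀ - f₀ * g₁ ≠ 0)
    (hF : (fun s => F s - (f₀ + f₁ * m₁ * s + f₂ / 2 * m₂ * s ^ 2 + f₃ / 6 * m₃ * s ^ 3))
      =o[𝓝 0] fun s => s ^ 3)
    (hG : (fun s => G s - (g₀ + g₁ * m₁ * s + g₂ / 2 * m₂ * s ^ 2 + g₃ / 6 * m₃ * s ^ 3))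
      =o[𝓝 0] fun s => s ^ 3) :
    (fun s => (f₁ * G s - g₁ * F s) / (f₁ * g₀ - f₀ * g₁) - 1) =O[𝓝 0] fun s => s ^ 2 := by
  have h32 : (fun s : ℝ => s ^ 3) =O[𝓝 0] fun s => s ^ 2 :=
    (isLittleO_pow_pow (by norm_num)).isBigO
  have h := (((hG.isBigO.trans h32).const_mul_left (f₁ / (f₁ * g₀ - f₀ * g₁))).sub
    ((hF.isBigO.trans h32).const_mul_left (g₁ / (f₁ * g₀ - f₀ * g₁)))).add
    (((isBigO_refl (fun s : ℝ => s ^ 2) _).const_mul_left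
      ((f₁ * g₂ - g₁ * f₂) / (f₁ * g₀ - f₀ * g₁) * m₂ / 2)).add
    (h32.const_mul_left ((f₁ * g₃ - g₁ * f₃) / (f₁ * g₀ - f₀ * g₁) * m₃ / 6)))
  refine h.congr_left fun s => ?_
  field_simp
  ring

theorem normalized_fst_sub_id_isBigO (hW : f₁ * g₀ - f₀ * g₁ ≠ 0)
    (hF : (fun s => F s - (f₀ + f₁ * s + f₂ / 2 * s ^ 2 + f₃ / 6 * s ^ 3))
      =o[𝓝 0] fun s => s ^ 3)
    (hG : (fun s => G s - (g₀ + g₁ * s + g₂ / 2 * s ^ 2 + g₃ / 6 * s ^ 3))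
      =o[𝓝 0] fun s => s ^ 3) :
    (fun s => (F s * g₀ - f₀ * G s) / (f₁ * g₀ - f₀ * g₁) - s) =O[𝓝 0] fun s => s ^ 2 := by
  have h32 : (fun s : ℝ => s ^ 3) =O[𝓝 0] fun s => s ^ 2 :=
    (isLittleO_pow_pow (by norm_num)).isBigO
  have h := normalized_fst_isLittleO (m₁ := 1) (m₂ := 1) (m₃ := 1) hW (by simpa using hF)
    (by simpa using hG)
  refine ((h.isBigO.trans h32).add
    (((isBigO_refl (fun s : ℝ => s ^ 2) _).const_mul_left
      ((f₂ * g₀ - f₀ * g₂) / (f₁ * g₀ - f₀ * g₁) * 1 / 2)).add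
    (h32.const_mul_left ((f₃ * g₀ - f₀ * g₃) / (f₁ * g₀ - f₀ * g₁) * 1 / 6)))).congr_left
      fun s => ?_
  ring

end Normalization

/-- The solution of the mean equation along a centred bounded perturbation has an expansion whose
coefficients are `coeffFst` and `coeffThird` times the second and third moments. -/
theorem implicit_mean_expansion {T : Type*} [MeasurableSpace T] {μ : Measure T}
    [IsProbabilityMeasure μ] {I : Set ℝ} (hI : IsOpen I) (hIc : I.OrdConnected) {f g : ℝ → ℝ}
    (hfg : ClassC 3 I f g) {x : ℝ} (hx : x ∈ I) {ψ : T → ℝ} (hψ : AEMeasurable ψ μ) {K : ℝ}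
    (hK : ∀ t, |ψ t| ≤ K) (hψ0 : ∫ t, ψ t ∂μ = 0) {w : ℝ → ℝ} (hw : w =O[𝓝 0] fun s => s)
    (heq : ∀ᶠ s in 𝓝 0, ∫ t, chebDet f g (x + s * ψ t) (x + w s) ∂μ = 0) :
    (fun s => w s - (coeffFst f g x * (∫ t, ψ t ^ 2 ∂μ) / 2 * s ^ 2
      + coeffThird f g x * (∫ t, ψ t ^ 3 ∂μ) / 6 * s ^ 3)) =o[𝓝 0] fun s => s ^ 3 := by
  have hW : deriv f x * g x - f x * deriv g x ≠ 0 := hfg.wronskian_ne_zero (by norm_num) x hx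
  obtain ⟨r, hr, hrI⟩ := Metric.isOpen_iff.1 hI x hx
  have hsmall : ∀ᶠ s : ℝ in 𝓝 0, |s| * K < r / 2 := by
    have : Tendsto (fun s : ℝ => |s| * K) (𝓝 0) (𝓝 0) := by
      have : Continuous fun s : ℝ => |s| * K := by fun_prop
      simpa using this.tendsto 0
    exact this.eventually_lt_const (by linarith)
  have hint : ∀ u : ℝ → ℝ, ContDiffOn ℝ 3 u I →
      ∀ᶠ s in 𝓝 0, Integrable (fun t => u (x + s * ψ t)) μ := by
    intro u hu
    filter_upwards [hsmall] with s hs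
    refine integrable_comp (a := x - r / 2) (b := x + r / 2) (by linarith)
      (hu.continuousOn.mono fun y hy => hrI ?_) ((hψ.const_mul s).const_add x) fun t => ?_
    · rw [Metric.mem_ball, Real.dist_eq, abs_lt]
      constructor <;> linarith [hy.1, hy.2]
    · have : |s * ψ t| < r / 2 := by
        rw [abs_mul]
        exact (mul_le_mul_of_nonneg_left (hK t) (abs_nonneg _)).trans_lt hs
      rw [abs_lt] at this
      constructor <;> linarith [this.1, this.2]
  have tf := taylor_three_isLittleO hI hIc hfg.contDiffOn_fst hx
  have tg := taylor_three_isLittleO hI hIc hfg.contDiffOn_snd hx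
  have ef := integral_expansion_isLittleO hψ hK (hint f hfg.contDiffOn_fst) tf
  have eg := integral_expansion_isLittleO hψ hK (hint g hfg.contDiffOn_snd) tg
  refine isLittleO_implicit (P := fun s => ((∫ t, f (x + s * ψ t) ∂μ) * g x
    - f x * ∫ t, g (x + s * ψ t) ∂μ) / (deriv f x * g x - f x * deriv g x)) hw ?_ ?_
    (normalized_snd_isBigO hW ef eg)
    (normalized_fst_sub_id_isBigO hW tf tg)
    (normalized_snd_isBigO (m₁ := 1) (m₂ := 1) (m₃ := 1) hW (by simpa using tf)
      (by simpa using tg))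
  · filter_upwards [heq, hint f hfg.contDiffOn_fst, hint g hfg.contDiffOn_snd] with s hs hfi hgi
    simp only [chebDet] at hs
    rw [integral_sub (hfi.mul_const _) (hgi.const_mul _), integral_mul_const,
      integral_const_mul] at hs
    -- Passing to the normalized basis multiplies the determinant by `W / W²`, with `W` the
    -- Wronskian at `x`.
    linear_combination (-(deriv f x * g x - f x * deriv g x)
      * (deriv f x * g x - f x * deriv g x)⁻¹ * (deriv f x * g x - f x * deriv g x)⁻¹) * hs
  · refine (normalized_fst_isLittleO hW ef eg).congr_left fun s => ?_
    rw [hψ0, coeffFst, coeffThird, wronskian]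
    ring

/-! ### Weighted arithmetic means and invariance under equivalence. -/

section WeightedFamily

variable {T : Type*} {d : ℕ} {I : Set ℝ} {φ : Fin d → T → ℝ}

theorem weightedFamily_mem (hIc : I.OrdConnected) (hφ0 : ∀ i t, φ i t ∈ Set.Icc (0 : ℝ) 1)
    (hφ1 : ∀ t, ∑ i, φ i t = 1) {x : Fin d → ℝ} (hx : x ∈ cube I d) (t : T) :
    weightedFamily φ x t ∈ I :=
  hIc.convex.sum_mem (fun i _ => (hφ0 i t).1) (hφ1 t) fun i _ => hx i

theorem abs_weightedFamily_le (hφ0 : ∀ i t, φ i t ∈ Set.Icc (0 : ℝ) 1) (z : Fin d → ℝ) (t : T) :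
    |weightedFamily φ z t| ≤ ∑ i, |z i| := by
  refine (Finset.abs_sum_le_sum_abs _ _).trans (Finset.sum_le_sum fun i _ => ?_)
  rw [abs_mul, abs_of_nonneg (hφ0 i t).1]
  exact mul_le_of_le_one_left (abs_nonneg _) (hφ0 i t).2

theorem weightedFamily_line (hφ1 : ∀ t, ∑ i, φ i t = 1) (x s : ℝ) (z : Fin d → ℝ) (t : T) :
    weightedFamily φ (fun i => x + s * z i) t = x + s * weightedFamily φ z t := by
  simp only [weightedFamily, mul_add, Finset.sum_add_distrib, Finset.mul_sum]
  rw [← Finset.sum_mul, hφ1, one_mul]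
  congr 1
  exact Finset.sum_congr rfl fun i _ => by ring

variable [MeasurableSpace T] {μ : Measure T}

theorem aemeasurable_weightedFamily (hφ : ∀ i, AEMeasurable (φ i) μ) (z : Fin d → ℝ) :
    AEMeasurable (weightedFamily φ z) μ :=
  Finset.aemeasurable_fun_sum _ fun i _ => (hφ i).mul_const _

/-- The two determinants differ by the factor `α δ - β γ`, so both means are chosen from the same
solution set. -/
theorem genBajMean_eq_of_pairEquiv (hIc : I.OrdConnected)
    (hφ0 : ∀ i t, φ i t ∈ Set.Icc (0 : ℝ) 1) (hφ1 : ∀ t, ∑ i, φ i t = 1)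
    {f g h k : ℝ → ℝ} (he : PairEquiv I f g h k) {x : Fin d → ℝ} (hx : x ∈ cube I d) :
    genBajMean I f g (weightedFamily φ) μ x = genBajMean I h k (weightedFamily φ) μ x := by
  obtain ⟨α, β, γ, δ, hdet, hcomb⟩ := he
  unfold genBajMean
  congr 1
  funext y
  refine propext (and_congr_right fun hy => ?_)
  have : ∀ t, chebDet f g (weightedFamily φ x t) y
      = (α * δ - β * γ) * chebDet h k (weightedFamily φ x t) y := by
    intro t
    have hm := weightedFamily_mem hIc hφ0 hφ1 hx t
    simp only [chebDet, hcomb y hy, hcomb _ hm]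
    ring
  simp only [this, integral_const_mul, mul_eq_zero, hdet, false_or]

end WeightedFamily

/-! ### Local expansion of the mean and recovery of the coefficients. -/

section Mean

variable {T : Type*} [MeasurableSpace T] {μ : Measure T} [IsProbabilityMeasure μ] {d : ℕ}
  {I : Set ℝ} {f g h k : ℝ → ℝ} {φ : Fin d → T → ℝ}

/-- Existence is applied on `[a, b]` itself, and uniqueness on `I` identifies that solution with the
mean. The localization supplies the a priori bound `w = O(s)`. -/
theorem genBajMean_spec_of_mem_Icc (hIc : I.OrdConnected) (hf : ContinuousOn f I)
    (hg : ContinuousOn g I) (hC : IsChebyshev I f g) {a b : ℝ} (hab : a ≤ b) (ha : a ∈ I)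
    (hb : b ∈ I) {m : (Fin d → ℝ) → T → ℝ} {x : Fin d → ℝ} (hm : AEMeasurable (m x) μ)
    (hmab : ∀ t, m x t ∈ Set.Icc a b) :
    genBajMean I f g m μ x ∈ Set.Icc a b ∧
      ∫ t, chebDet f g (m x t) (genBajMean I f g m μ x) ∂μ = 0 := by
  have hsub : Set.Icc a b ⊆ I := hIc.out ha hb
  have hI := existsUnique_chebDet_integral hIc hf hg hC hab ha hb hm hmab
  obtain ⟨y, ⟨hy, hy0⟩, -⟩ := existsUnique_chebDet_integral (μ := μ) (I := Set.Icc a b)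
    Set.ordConnected_Icc (hf.mono hsub) (hg.mono hsub)
    (fun u hu v hv => hC u (hsub hu) v (hsub hv)) hab ⟨le_rfl, hab⟩ ⟨hab, le_rfl⟩ hm hmab
  have hspec : genBajMean I f g m μ x ∈ I ∧
      ∫ t, chebDet f g (m x t) (genBajMean I f g m μ x) ∂μ = 0 :=
    Classical.epsilon_spec (p := fun y : ℝ => y ∈ I ∧ ∫ t, chebDet f g (m x t) y ∂μ = 0)
      hI.exists
  rw [hI.unique hspec ⟨hsub hy, hy0⟩]
  exact ⟨hy, hy0⟩

/-- Third-order expansion of the generalized Bajraktarević mean at a diagonal point, in a centred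
direction. -/
theorem genBajMean_expansion (hI : IsOpen I) (hIc : I.OrdConnected) (hfg : ClassC 3 I f g)
    (hφ : ∀ i, AEMeasurable (φ i) μ) (hφ0 : ∀ i t, φ i t ∈ Set.Icc (0 : ℝ) 1)
    (hφ1 : ∀ t, ∑ i, φ i t = 1) {x : ℝ} (hx : x ∈ I) {z : Fin d → ℝ}
    (hz : ∫ t, weightedFamily φ z t ∂μ = 0) :
    (fun s => genBajMean I f g (weightedFamily φ) μ (fun i => x + s * z i) - x
      - (coeffFst f g x * (∫ t, weightedFamily φ z t ^ 2 ∂μ) / 2 * s ^ 2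
        + coeffThird f g x * (∫ t, weightedFamily φ z t ^ 3 ∂μ) / 6 * s ^ 3)) =o[𝓝 0]
      fun s => s ^ 3 := by
  set K := ∑ i, |z i|
  have hK0 : 0 ≤ K := Finset.sum_nonneg fun i _ => abs_nonneg _
  have hK := abs_weightedFamily_le hφ0 z
  have hcont : Continuous fun s : ℝ => |s| * K := by fun_prop
  have hlow : ∀ᶠ s : ℝ in 𝓝 0, x - |s| * K ∈ I :=
    (continuous_const.sub hcont).continuousAt.eventually_mem (by simpa using hI.mem_nhds hx)
  have hupp : ∀ᶠ s : ℝ in 𝓝 0, x + |s| * K ∈ I :=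
    (continuous_const.add hcont).continuousAt.eventually_mem (by simpa using hI.mem_nhds hx)
  have hspec : ∀ᶠ s : ℝ in 𝓝 0,
      |genBajMean I f g (weightedFamily φ) μ (fun i => x + s * z i) - x| ≤ K * |s| ∧
      ∫ t, chebDet f g (x + s * weightedFamily φ z t)
        (x + (genBajMean I f g (weightedFamily φ) μ (fun i => x + s * z i) - x)) ∂μ = 0 := by
    filter_upwards [hlow, hupp] with s hl hu
    have hsK : 0 ≤ |s| * K := by positivity
    have := genBajMean_spec_of_mem_Icc (μ := μ) (m := weightedFamily φ)
      (x := fun i => x + s * z i) hIc hfg.contDiffOn_fst.continuousOn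
      hfg.contDiffOn_snd.continuousOn hfg.chebyshev (by linarith) hl hu
      (aemeasurable_weightedFamily hφ _) fun t => by
        have hb : |s * weightedFamily φ z t| ≤ |s| * K := by
          rw [abs_mul]
          exact mul_le_mul_of_nonneg_left (hK t) (abs_nonneg _)
        rw [abs_le] at hb
        rw [weightedFamily_line hφ1]
        constructor <;> linarith [hb.1, hb.2]
    simp only [weightedFamily_line hφ1] at this
    refine ⟨?_, by simpa using this.2⟩
    rw [abs_le]
    constructor <;> linarith [this.1.1, this.1.2]
  exact implicit_mean_expansion hI hIc hfg hx (aemeasurable_weightedFamily hφ z) hK hz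
    (IsBigO.of_bound K (hspec.mono fun s hs => hs.1)) (hspec.mono fun s hs => hs.2)

/-- Polarization of the third moment. -/
theorem exists_integral_cube_ne_zero {A B C : T → ℝ} (hA : AEMeasurable A μ)
    (hB : AEMeasurable B μ) (hC : AEMeasurable C μ) {K : ℝ} (hAK : ∀ t, |A t| ≤ K)
    (hBK : ∀ t, |B t| ≤ K) (hCK : ∀ t, |C t| ≤ K) (hne : ∫ t, A t * B t * C t ∂μ ≠ 0) :
    ∃ a b c : ℝ, ∫ t, (a * A t + b * B t + c * C t) ^ 3 ∂μ ≠ 0 := by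
  by_contra! hall
  have hint : ∀ a b c : ℝ, Integrable (fun t => (a * A t + b * B t + c * C t) ^ 3) μ := by
    intro a b c
    refine Integrable.of_bound
      ((((hA.const_mul a).add (hB.const_mul b)).add (hC.const_mul c)).pow_const
        3).aestronglyMeasurable ((|a| * K + |b| * K + |c| * K) ^ 3) (Eventually.of_forall fun t => ?_)
    rw [Real.norm_eq_abs, abs_pow]
    refine pow_le_pow_left₀ (abs_nonneg _) ((abs_add_three _ _ _).trans ?_) 3
    simp only [abs_mul]
    gcongr
    exacts [hAK t, hBK t, hCK t]
  -- The factors `0` and `1` are kept so that each cube is literally an instance of `hall`.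
  have hpol : ∀ t, A t * B t * C t = 1 / 6 * (((1 * A t + 1 * B t + 1 * C t) ^ 3
      - (1 * A t + 1 * B t + 0 * C t) ^ 3 - (1 * A t + 0 * B t + 1 * C t) ^ 3
      - (0 * A t + 1 * B t + 1 * C t) ^ 3) + ((1 * A t + 0 * B t + 0 * C t) ^ 3
      + (0 * A t + 1 * B t + 0 * C t) ^ 3 + (0 * A t + 0 * B t + 1 * C t) ^ 3)) := fun t => by ring
  refine hne ?_
  simp_rw [hpol]
  rw [integral_const_mul, integral_add, integral_sub, integral_sub, integral_sub, integral_add,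
    integral_add]
  · simp only [hall]
    norm_num
  all_goals
    repeat' first
    | exact hint _ _ _
    | apply Integrable.sub
    | apply Integrable.add

/-- If some mixed third central moment of the weights does not vanish, then neither do the second
and third moments of some centred combination of the weights. -/
theorem exists_centred_direction (hφ : ∀ i, AEMeasurable (φ i) μ)
    (hφ0 : ∀ i t, φ i t ∈ Set.Icc (0 : ℝ) 1) (hφ1 : ∀ t, ∑ i, φ i t = 1)
    (h3 : ∃ i j l : Fin d, ∫ t, centred μ (φ i) t * centred μ (φ j) t * centred μ (φ l) t ∂μ ≠ 0) :
    ∃ z : Fin d → ℝ, ∫ t, weightedFamily φ z t ∂μ = 0 ∧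
      ∫ t, weightedFamily φ z t ^ 2 ∂μ ≠ 0 ∧ ∫ t, weightedFamily φ z t ^ 3 ∂μ ≠ 0 := by
  obtain ⟨i, j, l, hne⟩ := h3
  have hφi : ∀ i, Integrable (φ i) μ := fun i =>
    Integrable.of_bound (hφ i).aestronglyMeasurable 1 (Eventually.of_forall fun t => by
      rw [Real.norm_eq_abs, abs_of_nonneg (hφ0 i t).1]
      exact (hφ0 i t).2)
  have hmeas : ∀ i, AEMeasurable (centred μ (φ i)) μ := fun i => (hφ i).sub_const _
  have hbd : ∀ i t, |centred μ (φ i) t| ≤ 1 := by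
    intro i t
    have h0 : 0 ≤ ∫ s, φ i s ∂μ := integral_nonneg fun s => (hφ0 i s).1
    have h1 : ∫ s, φ i s ∂μ ≤ 1 := by
      simpa using integral_mono (hφi i) (integrable_const (1 : ℝ)) fun s => (hφ0 i s).2
    rw [centred, abs_le]
    constructor <;> linarith [(hφ0 i t).1, (hφ0 i t).2]
  have hzero : ∀ i, ∫ t, centred μ (φ i) t ∂μ = 0 := by
    intro i
    simp only [centred]
    rw [integral_sub (hφi i) (integrable_const _)]
    simp
  have hci : ∀ i, Integrable (centred μ (φ i)) μ := fun i => (hφi i).sub (integrable_const _)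
  obtain ⟨a, b, c, habc⟩ :=
    exists_integral_cube_ne_zero (hmeas i) (hmeas j) (hmeas l) (hbd i) (hbd j) (hbd l) hne
  -- Because the weights sum to one, subtracting a constant from all coordinates subtracts it from
  -- the mean; so `φ_n*` is itself a weighted combination.
  have hdir : ∀ n t, weightedFamily φ (fun p => (Pi.single n 1 : Fin d → ℝ) p - ∫ s, φ n s ∂μ) t
      = centred μ (φ n) t := by
    intro n t
    simp only [weightedFamily, mul_sub, Finset.sum_sub_distrib, centred]
    rw [← Finset.sum_mul, hφ1, one_mul]
    simp [Pi.single_apply]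
  obtain ⟨z, hz⟩ : ∃ z : Fin d → ℝ, ∀ t, weightedFamily φ z t
      = a * centred μ (φ i) t + b * centred μ (φ j) t + c * centred μ (φ l) t := by
    refine ⟨fun p => a * ((Pi.single i 1 : Fin d → ℝ) p - ∫ s, φ i s ∂μ)
      + b * ((Pi.single j 1 : Fin d → ℝ) p - ∫ s, φ j s ∂μ)
      + c * ((Pi.single l 1 : Fin d → ℝ) p - ∫ s, φ l s ∂μ), fun t => ?_⟩
    rw [← hdir i, ← hdir j, ← hdir l]
    simp only [weightedFamily, Finset.mul_sum, ← Finset.sum_add_distrib]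
    exact Finset.sum_congr rfl fun p _ => by ring
  have hz3 : ∫ t, weightedFamily φ z t ^ 3 ∂μ ≠ 0 := by simpa only [hz] using habc
  refine ⟨z, ?_, fun h2 => hz3 ?_, hz3⟩
  · simp only [hz]
    have hij : Integrable (fun t => a * centred μ (φ i) t + b * centred μ (φ j) t) μ :=
      ((hci i).const_mul a).add ((hci j).const_mul b)
    rw [integral_add hij ((hci l).const_mul c),
      integral_add ((hci i).const_mul a) ((hci j).const_mul b)]
    simp only [integral_const_mul, hzero]
    ring
  -- A zero second moment would make the combination vanish almost everywhere, and its third moment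
  -- with it.
  · have hint2 : Integrable (fun t => weightedFamily φ z t ^ 2) μ :=
      Integrable.of_bound ((aemeasurable_weightedFamily hφ z).pow_const 2).aestronglyMeasurable
        ((∑ i, |z i|) ^ 2) (Eventually.of_forall fun t => by
          rw [Real.norm_eq_abs, abs_pow]
          exact pow_le_pow_left₀ (abs_nonneg _) (abs_weightedFamily_le hφ0 z t) 2)
    have hae := (integral_eq_zero_iff_of_nonneg (fun t => sq_nonneg _) hint2).1 h2
    refine integral_eq_zero_of_ae ?_
    filter_upwards [hae] with t ht
    have : weightedFamily φ z t = 0 := by simpa using ht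
    simp [this]

/-- Equality of the means near a diagonal point forces equality of the coefficients there. -/
theorem coeff_eq_of_genBajMean_eventuallyEq (hI : IsOpen I) (hIc : I.OrdConnected)
    (hfg : ClassC 3 I f g) (hhk : ClassC 3 I h k) (hφ : ∀ i, AEMeasurable (φ i) μ)
    (hφ0 : ∀ i t, φ i t ∈ Set.Icc (0 : ℝ) 1) (hφ1 : ∀ t, ∑ i, φ i t = 1) {z : Fin d → ℝ}
    (hz : ∫ t, weightedFamily φ z t ∂μ = 0) (hz2 : ∫ t, weightedFamily φ z t ^ 2 ∂μ ≠ 0)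
    (hz3 : ∫ t, weightedFamily φ z t ^ 3 ∂μ ≠ 0) {x : ℝ} (hx : x ∈ I)
    (heq : ∀ᶠ y in 𝓝 (fun _ : Fin d => x), genBajMean I f g (weightedFamily φ) μ y
      = genBajMean I h k (weightedFamily φ) μ y) :
    coeffFst f g x = coeffFst h k x ∧ coeffThird f g x = coeffThird h k x := by
  have h1 := genBajMean_expansion hI hIc hfg hφ hφ0 hφ1 hx hz
  have h2 := genBajMean_expansion hI hIc hhk hφ hφ0 hφ1 hx hz
  have hline : Tendsto (fun s : ℝ => fun i => x + s * z i) (𝓝 0) (𝓝 fun _ : Fin d => x) := by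
    have : Continuous fun s : ℝ => fun i => x + s * z i := by fun_prop
    simpa using this.tendsto 0
  have hdiff := (h2.sub h1).congr' (f₂ := fun s =>
    ((coeffFst f g x - coeffFst h k x) * (∫ t, weightedFamily φ z t ^ 2 ∂μ) / 2) * s ^ 2
    + ((coeffThird f g x - coeffThird h k x) * (∫ t, weightedFamily φ z t ^ 3 ∂μ) / 6) * s ^ 3)
    (by
      filter_upwards [hline.eventually heq] with s hs
      rw [hs]
      ring) EventuallyEq.rfl
  obtain ⟨e1, e2⟩ := coeff_eq_zero_of_isLittleO hdiff
  constructor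
  · have : coeffFst f g x - coeffFst h k x = 0 := by simpa [hz2] using e1
    linarith
  · have : coeffThird f g x - coeffThird h k x = 0 := by simpa [hz3] using e2
    linarith

end Mean

end Bajraktarevic

/-! ### Equality of means and equivalence of pairs. -/

theorem mainTheorem7 {T : Type*} [MeasurableSpace T] (μ : Measure T) [IsProbabilityMeasure μ]
    (d : ℕ) (I : Set ℝ) (hI_open : IsOpen I) (hI_conn : I.OrdConnected) (hI_ne : I.Nonempty)
    (f g h k : ℝ → ℝ)
    (hfg : Bajraktarevic.ClassC 3 I f g) (hhk : Bajraktarevic.ClassC 3 I h k)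
    (φ : Fin d → T → ℝ) (hφ_meas : ∀ i, AEMeasurable (φ i) μ)
    (hφ_mem : ∀ i t, φ i t ∈ Set.Icc (0 : ℝ) 1) (hφ_sum : ∀ t, ∑ i, φ i t = 1)
    (hφ_ne : μ {t | ∀ i, Bajraktarevic.centred μ (φ i) t = 0} < 1)
    (hφ_third : ∃ i j l : Fin d,
      ∫ t, Bajraktarevic.centred μ (φ i) t * Bajraktarevic.centred μ (φ j) t *
        Bajraktarevic.centred μ (φ l) t ∂μ ≠ 0) :
    List.TFAE [
      ∀ x ∈ Bajraktarevic.cube I d,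
        Bajraktarevic.genBajMean I f g (Bajraktarevic.weightedFamily φ) μ x
          = Bajraktarevic.genBajMean I h k (Bajraktarevic.weightedFamily φ) μ x,
      ∃ D : Set ℝ, D ⊆ I ∧ I ⊆ closure D ∧
        ∃ U : Set (Fin d → ℝ), IsOpen U ∧ U ⊆ Bajraktarevic.cube I d ∧
          (∀ x ∈ D, (fun _ : Fin d => x) ∈ U) ∧
          ∀ x ∈ U, Bajraktarevic.genBajMean I f g (Bajraktarevic.weightedFamily φ) μ x
            = Bajraktarevic.genBajMean I h k (Bajraktarevic.weightedFamily φ) μ x,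
      Bajraktarevic.PairEquiv I f g h k] := by

  tfae_have 1 → 2 := fun h1 =>
    ⟨I, subset_rfl, subset_closure, Bajraktarevic.cube I d, by
      have : Bajraktarevic.cube I d = Set.univ.pi fun _ => I := by
        ext x
        simp [Bajraktarevic.cube]
      rw [this]
      exact isOpen_set_pi Set.finite_univ fun _ _ => hI_open,
      subset_rfl, fun x hx _ => hx, h1⟩
  tfae_have 2 → 3 := by
    rintro ⟨D, hDI, hID, U, hU, -, hDU, heq⟩
    -- One direction serves every diagonal point, since the moments do not depend on `x`.
    obtain ⟨z, hz, hz2, hz3⟩ :=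
      Bajraktarevic.exists_centred_direction hφ_meas hφ_mem hφ_sum hφ_third
    have hcoeff := fun x (hx : x ∈ D) =>
      Bajraktarevic.coeff_eq_of_genBajMean_eventuallyEq hI_open hI_conn hfg hhk hφ_meas hφ_mem
        hφ_sum hz hz2 hz3 (hDI hx)
        (Filter.mem_of_superset (hU.mem_nhds (hDU x hx)) fun y hy => heq y hy)
    refine Bajraktarevic.pairEquiv_of_coeff_eq hI_open hI_conn.isPreconnected hI_ne hfg hhk ?_ ?_
    · exact Set.EqOn.of_subset_closure (fun x hx => (hcoeff x hx).1)
        (fun x hx => (hfg.hasDerivAt_coeffFst hI_open hx).continuousAt.continuousWithinAt)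
        (fun x hx => (hhk.hasDerivAt_coeffFst hI_open hx).continuousAt.continuousWithinAt) hDI hID
    · exact Set.EqOn.of_subset_closure (fun x hx => (hcoeff x hx).2)
        (hfg.continuousOn_coeffThird hI_open) (hhk.continuousOn_coeffThird hI_open) hDI hID
  tfae_have 3 → 1 := fun h3 x hx =>
    Bajraktarevic.genBajMean_eq_of_pairEquiv hI_conn hφ_mem hφ_sum h3 hx
  tfae_finish
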